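/- Let $R$ be a complete discrete valuation ring with maximal ideal $P$ and quotient field $K$, and let $\Lambda=(P^{\alpha_{ij}})\subseteq M_n(K)$ be a tiled $R$-order, where $\alpha_{ij}$ are non-negative integers with $\alpha_{ii}=0$ and $\alpha_{ij}+\alpha_{jk}\ge\alpha_{ik}$ for all $i,j,k$; thus $\Lambda$ is the $R$-algebra of all matrices $x \in M_n(K)$ with $x_{ij}\in P^{\alpha_{ij}}$ for all $i,j$. Assume that $\Lambda$ is basic, i.e. that the left $\Lambda$-modules $\Lambda e_{11},\dots,\Lambda e_{nn}$ ($e_{ii}$ the diagonal matrix units) are pairwise non-isomorphic, and that it is a $(0,1)$-order, i.e. that $\alpha_{ij}\in\{0,1\}$ for all $i,j$. For $1\le k\le n$ let $M_k=\{x\in\Lambda : x_{kk}\in P\}$; since $\Lambda$ is basic, $M_1,\dots,M_n$ are its maximal two-sided ideals. The link graph $Q(\Lambda)$ is the quiver with vertices $1,\dots,n$ and an arrow from $i$ to $j$ (possibly $i=j$) if and only if $M_jM_i\ne M_j\cap M_i$. Let $\operatorname{Aut}(Q(\Lambda))$ be the group of permutations $\sigma$ of $\{1,\dots,n\}$ such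 that there is an arrow from $i$ to $j$ if and only if there is one from $\sigma(i)$ to $\sigma(j)$. Let $\operatorname{Aut}_R(\Lambda)$ be the group of $R$-algebra automorphisms of $\Lambda$ and $\operatorname{Inn}(\Lambda)$ its subgroup of conjugations by units of $\Lambda$. An automorphism $\varphi\in\operatorname{Aut}_R(\Lambda)$ induces $\sigma$ if $\varphi(M_i)=M_{\sigma(i)}$ for all $i$, and $\sigma\in\operatorname{Aut}(Q(\Lambda))$ is called liftable if it is induced by some $\varphi\in\operatorname{Aut}_R(\Lambda)$. Then every $\sigma\in\operatorname{Aut}(Q(\Lambda))$ is liftable. Consequently $\operatorname{Aut}_R(\Lambda)\cong\operatorname{Inn}(\Lambda)\rtimes\operatorname{Aut}(Q(\Lambda))$; more precisely, there is such an isomorphism, for some action of $\operatorname{Aut}(Q(\Lambda))$ on $\operatorname{Inn}(\Lambda)$, that restricts to the inclusion on $\operatorname{Inn}(\Lambda)$ and sends each $\sigma\in\operatorname{Aut}(Q(\Lambda))$ to an automorphism of $\Lambda$ that induces $\sigma$. -/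

import Mathlib

/-!
If `Λ` is basic, then `i ≤ j ↔ α i j = 0` is a partial order on the vertices, and for a
`(0,1)`-order its link graph has an arrow from `i` to `j` if and only if `i` covers `j`, or `j` is
maximal and `i` is minimal. A permutation `σ` of the vertices preserving these arrows is either an
automorphism of the poset, or it reverses the order of the two summands in a decomposition of the
poset as an ordinal sum. In both cases `α (σ i) (σ j) = α i j + d i - d j` for some integers `d i`.
Hence `σ` preserves the structure constants `α i j + α j k - α i k` of `Λ` in the basis
`p ^ α i j * e_{ij}`, where `p` generates `P`, and permuting this basis by `σ` is an automorphism
of `Λ`. This splits the action of `Aut_R(Λ)` on the link graph.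

It remains to see that an automorphism `φ` with `φ(M_i) = M_i` for all `i` is inner. The element
`u = ∑ i, φ(e_i) * e_i` is not in any `M_i`, so it is a unit, and `φ(e_i) = u e_i u⁻¹`. After
dividing `φ` by conjugation by `u` we may assume that it fixes the `e_i`. Then it multiplies the
basis element at `(i, j)` by a unit `c i j` of `R` with `c i j * c j k = c i k`, so it is
conjugation by the diagonal matrix with entries `c i k` for any fixed `k`.
-/

open scoped Matrix

/-- An exponent matrix: a matrix of non-negative integers `α i j` with `α i i = 0` and
`α i k ≤ α i j + α j k`. -/
structure ExponentMatrix (n : ℕ) where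
  /-- The entries `α i j`. -/
  exp : Fin n → Fin n → ℕ
  diag : ∀ i, exp i i = 0
  triangle : ∀ i j k, exp i k ≤ exp i j + exp j k

namespace TiledOrder

section

variable (R K : Type*) [CommRing R] [IsDomain R] [IsDiscreteValuationRing R]
  [Field K] [Algebra R K]

/-- The `R`-submodule `P ^ a` of `K`, where `P` is the maximal ideal of `R`. -/
def primePow (a : ℕ) : Submodule R K :=
  IsLocalization.coeSubmodule K (IsLocalRing.maximalIdeal R ^ a)

lemma primePow_anti {a b : ℕ} (h : a ≤ b) : primePow R K b ≤ primePow R K a :=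
  Submodule.map_mono (Ideal.pow_le_pow_right h)

lemma mul_mem_primePow {a b : ℕ} {x y : K} (hx : x ∈ primePow R K a)
    (hy : y ∈ primePow R K b) : x * y ∈ primePow R K (a + b) := by
  unfold primePow at *
  rw [pow_add, IsLocalization.coeSubmodule_mul]
  exact Submodule.mul_mem_mul hx hy

lemma algebraMap_mem_primePow_zero (r : R) : algebraMap R K r ∈ primePow R K 0 := by
  unfold primePow
  rw [IsLocalization.mem_coeSubmodule]
  exact ⟨r, by simp, rfl⟩

variable {n : ℕ} (α : ExponentMatrix n)

/-- The tiled `R`-order `Λ = (P ^ α i j)` in the matrix ring `M_n(K)`. -/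
def order : Subalgebra R (Matrix (Fin n) (Fin n) K) where
  carrier := {x | ∀ i j, x i j ∈ primePow R K (α.exp i j)}
  mul_mem' := by
    intro x y hx hy i k
    rw [Matrix.mul_apply]
    exact Submodule.sum_mem _ fun j _ =>
      primePow_anti R K (α.triangle i j k) (mul_mem_primePow R K (hx i j) (hy j k))
  add_mem' := by
    intro x y hx hy i j
    exact Submodule.add_mem _ (hx i j) (hy i j)
  algebraMap_mem' := by
    intro r i j
    rw [Matrix.algebraMap_matrix_apply]
    split_ifs with h
    · subst h
      rw [α.diag]
      exact algebraMap_mem_primePow_zero R K r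
    · exact Submodule.zero_mem _

/-- The diagonal matrix unit `e i = e_{ii}`, as an element of `Λ`. -/
def idem (i : Fin n) : order R K α :=
  ⟨Matrix.single i i 1, by
    intro a b
    rw [Matrix.single_apply]
    split_ifs with h
    · obtain ⟨rfl, rfl⟩ := h
      rw [α.diag]
      simpa using algebraMap_mem_primePow_zero R K 1
    · exact Submodule.zero_mem _⟩

/-- The `i`-th column `Λ e_i` of `Λ`, a projective left `Λ`-module. -/
def column (i : Fin n) : Submodule (order R K α) (order R K α) :=
  Submodule.span (order R K α) {idem R K α i}

/-- `Λ` is basic if its indecomposable projective modules `Λ e_1, …, Λ e_n` are pairwise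
non-isomorphic. -/
def IsBasic : Prop :=
  ∀ i j : Fin n, i ≠ j →
    IsEmpty (column R K α i ≃ₗ[order R K α] column R K α j)

/-- The set `M_k ⊆ Λ` obtained from `Λ = (P ^ α i j)` by replacing the `R` in position `(k, k)`
by `P`. If `Λ` is basic, then `M_1, …, M_n` are its maximal two-sided ideals. -/
def maxIdeal (k : Fin n) : Submodule R (order R K α) where
  carrier := {x | (x : Matrix (Fin n) (Fin n) K) k k ∈ primePow R K 1}
  add_mem' := fun hx hy => (primePow R K 1).add_mem hx hy
  zero_mem' := (primePow R K 1).zero_mem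
  smul_mem' := fun r _ hx => (primePow R K 1).smul_mem r hx

/-- The link graph `Q(Λ)`: the vertices are `1, …, n`, and there is an arrow from `i` to `j` if and
only if `M_j M_i ≠ M_j ∩ M_i`. Loops are allowed. The product is the additive span of all products
of two elements. -/
def linkGraph : Digraph (Fin n) where
  Adj i j := maxIdeal R K α j * maxIdeal R K α i ≠ maxIdeal R K α j ⊓ maxIdeal R K α i

/-- The group `Aut(Q(Λ))` of permutations of the vertices that preserve and reflect arrows;
the product is composition. -/
abbrev LinkGraphAut : Type :=
  (linkGraph R K α).Adj ≃r (linkGraph R K α).Adj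

variable {R K α}

/-- The `R`-automorphism `φ` of `Λ` induces the permutation `σ` of the vertices of the link graph:
`φ(M_i) = M_{σ(i)}` for all `i`. -/
def Induces (φ : order R K α ≃ₐ[R] order R K α) (σ : Equiv.Perm (Fin n)) : Prop :=
  ∀ i, (maxIdeal R K α i).map φ.toLinearMap = maxIdeal R K α (σ i)

/-- An automorphism of the link graph is liftable if it is induced by an `R`-automorphism
of `Λ`. -/
def IsLiftable (σ : LinkGraphAut R K α) : Prop :=
  ∃ φ : order R K α ≃ₐ[R] order R K α, Induces φ σ.toEquiv

end

/-- The group `Inn(A)` of inner automorphisms `x ↦ u x u⁻¹`, `u ∈ Aˣ`, of an `R`-algebra `A`,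
as a subgroup of the group of `R`-algebra automorphisms of `A`. -/
def inner (R A : Type*) [CommRing R] [Ring A] [Algebra R A] : Subgroup (A ≃ₐ[R] A) where
  carrier := {φ | ∃ u : Aˣ, ∀ x, φ x = u * x * (u⁻¹ : Aˣ)}
  mul_mem' := by
    rintro φ ψ ⟨u, hu⟩ ⟨v, hv⟩
    exact ⟨u * v, fun x => by simp [AlgEquiv.mul_apply, hu, hv, mul_assoc]⟩
  one_mem' := ⟨1, fun x => by simp⟩
  inv_mem' := by
    rintro φ ⟨u, hu⟩
    refine ⟨u⁻¹, fun x => φ.injective ?_⟩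
    rw [hu (_ * _ * _)]
    have h : φ (φ⁻¹ x) = x := φ.apply_symm_apply x
    rw [h]
    simp [mul_assoc]

end TiledOrder

lemma iInf_le_iff_exists_le {ι : Type*} [Nonempty ι] {f : ι → ℕ} {m : ℕ} :
    ⨅ c, f c ≤ m ↔ ∃ c, f c ≤ m := by
  refine ⟨fun h ↦ ?_, fun ⟨c, hc⟩ ↦ (ciInf_le (OrderBot.bddBelow _) c).trans hc⟩
  obtain ⟨c, hc⟩ := Nat.sInf_mem (Set.range_nonempty f)
  exact ⟨c, hc.trans_le h⟩

section Algebra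

open Polynomial in
lemma isUnit_of_aeval_eq_zero {R A : Type*} [CommRing R] [Ring A] [Algebra R A] {x : A} {q : R[X]}
    (hq : aeval x q = 0) (h : IsUnit (q.coeff 0)) : IsUnit x := by
  have hcomm : Commute x (aeval x q.divX) := by
    simpa using (Commute.all X q.divX).map (aeval x)
  rw [← q.divX_mul_X_add, map_add, map_mul, aeval_X, aeval_C] at hq
  have hunit : IsUnit (aeval x q.divX * x) := by
    rw [eq_neg_of_add_eq_zero_left hq]
    exact (h.map (algebraMap R A)).neg
  exact (hcomm.symm.isUnit_mul_iff.1 hunit).2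

lemma det_eq_prod_diag_of_forall_not_le {m R : Type*} [Fintype m] [DecidableEq m] [PartialOrder m]
    [CommRing R] {M : Matrix m m R} (hM : ∀ i j, ¬ i ≤ j → M i j = 0) :
    M.det = ∏ i, M i i := by
  let _ : LinearOrder m := instLinearOrderLinearExtensionOfPartialOrder
  convert Matrix.det_of_isUpperTriangular (M := M) fun i j hji ↦ hM i j fun hij ↦ ?_
  exact (toLinearExtension.monotone hij).not_gt hji

lemma isUnit_of_eq_map_of_isUnit_det {m R B : Type*} [Fintype m] [DecidableEq m] [CommRing R]
    [CommRing B] [Algebra R B] {S : Subalgebra R (Matrix m m B)} {x : S} {M : Matrix m m R}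
    (hx : (x : Matrix m m B) = M.map (algebraMap R B)) (hM : IsUnit M.det) : IsUnit x := by
  have hcharpoly : Polynomial.aeval (M.map (algebraMap R B)) M.charpoly = 0 := by
    simpa only [← Polynomial.aeval_algHom_apply, map_zero] using!
      congrArg (Algebra.ofId R B).mapMatrix M.aeval_self_charpoly
  refine isUnit_of_aeval_eq_zero (q := M.charpoly) (Subtype.val_injective ?_) ?_
  · rwa [← hx, ← S.coe_val, Polynomial.aeval_algHom_apply, ← map_zero S.val] at hcharpoly
  · rw [M.det_eq_sign_charpoly_coeff] at hM
    exact isUnit_of_mul_isUnit_right hM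

lemma nonempty_span_linearEquiv_span {A : Type*} [Ring A] {e f a b : A} (hab : a * b = e)
    (hba : b * a = f) (he : e * e = e) (hf : f * f = f) :
    Nonempty (Submodule.span A {e} ≃ₗ[A] Submodule.span A {f}) := by
  subst hab hba
  let mulRight (c : A) : A →ₗ[A] A := LinearMap.toSpanSingleton A A c
  refine ⟨.ofLinearMap ((mulRight a).restrict fun x hx ↦ ?_) ((mulRight b).restrict fun x hx ↦ ?_)
    (LinearMap.ext fun ⟨x, hx⟩ ↦ Subtype.ext ?_) (LinearMap.ext fun ⟨x, hx⟩ ↦ Subtype.ext ?_)⟩ <;>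
    obtain ⟨y, rfl⟩ := Submodule.mem_span_singleton.1 hx
  · exact Submodule.mem_span_singleton.2 ⟨y * a, by simp [mulRight, mul_assoc]⟩
  · exact Submodule.mem_span_singleton.2 ⟨y * b, by simp [mulRight, mul_assoc]⟩
  · simpa [mulRight, mul_assoc] using congrArg (y * ·) hf
  · simpa [mulRight, mul_assoc] using congrArg (y * ·) he

lemma mem_inner_of_isUnit {R A : Type*} [CommRing R] [Ring A] [Algebra R A] {φ : A ≃ₐ[R] A} {u : A}
    (hu : IsUnit u) (h : ∀ x, φ x * u = u * x) : φ ∈ TiledOrder.inner R A := by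
  obtain ⟨u, rfl⟩ := hu
  exact ⟨u, fun x ↦ by rw [← h, Units.mul_inv_cancel_right]⟩

lemma mul_sum_mul_eq_sum_mul_mul_of_orthogonalIdempotents
    {A I : Type*} [Semiring A] [Fintype I] {e f : I → A}
    (he : OrthogonalIdempotents e) (hf : OrthogonalIdempotents f) (i : I) :
    f i * ∑ j, f j * e j = (∑ j, f j * e j) * e i := by
  classical
  simp only [Finset.mul_sum, Finset.sum_mul, ← mul_assoc, hf.mul_eq]
  simp [mul_assoc, he.mul_eq]

end Algebra

/-! ### Links in a finite poset -/

section Poset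

variable {V W : Type*} [PartialOrder V] [PartialOrder W]

lemma monotoneOn_of_forall_covBy_le [Finite V] {f : V → W} {S : Set V} (hS : S.OrdConnected)
    (hf : ∀ a ∈ S, ∀ b ∈ S, a ⋖ b → f a ≤ f b) : MonotoneOn f S := by
  have := Fintype.ofFinite V
  classical
  let _ : LocallyFiniteOrder S := Fintype.toLocallyFiniteOrder
  have hmono : Monotone (S.domRestrict f) := (monotone_iff_forall_covBy _).2 fun a b hab ↦
    hf a a.2 b b.2 <| (Set.OrdConnected.apply_covBy_apply_iff (OrderEmbedding.subtype (· ∈ S))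
      (by simpa using hS)).2 hab
  exact Set.monotoneOn_iff_monotone.2 hmono

lemma exists_isMax_ge [Finite V] (x : V) : ∃ t, IsMax t ∧ x ≤ t := by
  obtain ⟨t, hxt, ht⟩ := Set.finite_univ.exists_le_maximal (Set.mem_univ x)
  exact ⟨t, fun _ hty ↦ ht.2 (Set.mem_univ _) hty, hxt⟩

lemma exists_isMin_le [Finite V] (x : V) : ∃ s, IsMin s ∧ s ≤ x :=
  exists_isMax_ge (V := Vᵒᵈ) x

/-- The arrows `x → y` of the link graph of a tiled `(0,1)`-order, read off from the partial order
`i ≤ j ↔ α i j = 0` on its vertices. -/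
def IsLink (x y : V) : Prop := y ⋖ x ∨ (IsMax y ∧ IsMin x)

lemma isLink_iff_isMin {x t : V} (ht : IsMax t) : IsLink x t ↔ IsMin x :=
  ⟨fun h ↦ h.elim (fun hc ↦ absurd hc.lt ht.not_lt) And.right, fun hx ↦ .inr ⟨ht, hx⟩⟩

lemma isLink_iff_of_lt {x y : V} (h : y < x) :
    IsLink x y ↔ ∀ c, c ≠ x → c ≠ y → ¬(y ≤ c ∧ c ≤ x) := by
  have hx : ¬IsMin x := fun hx ↦ hx.not_lt h
  simp only [IsLink, CovBy, h, hx, true_and, and_false, or_false]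
  simp only [lt_iff_le_and_ne]
  grind

lemma isLink_iff_of_not_lt {x y : V} (h : ¬y < x) :
    IsLink x y ↔ ∀ c, c ≠ x → c ≠ y → ¬y ≤ c ∧ ¬c ≤ x := by
  simp only [IsLink, CovBy, h, false_and, false_or, isMax_iff_forall_not_lt,
    isMin_iff_forall_not_lt]
  simp only [lt_iff_le_and_ne] at h ⊢
  grind

namespace IsLink

variable {σ : (IsLink : V → V → Prop) ≃r (IsLink : W → W → Prop)}

lemma monotoneOn_of_forall_not_isMax_map [Finite V] {S : Set V} (hS : S.OrdConnected)
    (h : ∀ a ∈ S, ¬ IsMax (σ a)) : MonotoneOn σ S :=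
  monotoneOn_of_forall_covBy_le hS fun a ha _ _ hab ↦
    ((σ.map_rel_iff.2 (.inl hab)).resolve_right fun hσ ↦ h a ha hσ.1).le

lemma monotoneOn_of_forall_not_isMin_map [Finite V] {S : Set V} (hS : S.OrdConnected)
    (h : ∀ b ∈ S, ¬ IsMin (σ b)) : MonotoneOn σ S :=
  monotoneOn_of_forall_covBy_le hS fun _ _ b hb hab ↦
    ((σ.map_rel_iff.2 (.inl hab)).resolve_right fun hσ ↦ h b hb hσ.2).le

lemma isMin_map_iff {t : V} (ht : IsMax t) (hσt : IsMax (σ t)) (x : V) :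
    IsMin (σ x) ↔ IsMin x := by
  rw [← isLink_iff_isMin hσt, σ.map_rel_iff, isLink_iff_isMin ht]

lemma monotone_of_isMax_map [Finite V] {t : V} (ht : IsMax t) (hσt : IsMax (σ t)) :
    Monotone σ := by
  refine monotoneOn_univ.1 <| monotoneOn_of_forall_covBy_le Set.ordConnected_univ
    fun a _ b _ hab ↦ ((σ.map_rel_iff.2 (.inl hab)).resolve_right fun hσ ↦ ?_).le
  exact ((isMin_map_iff ht hσt b).1 hσ.2).not_lt hab.lt

lemma not_isMax_symm (h : ∀ t, IsMax t → ¬ IsMax (σ t)) (t : W) (ht : IsMax t) :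
    ¬ IsMax (σ.symm t) :=
  fun hσt ↦ h _ hσt (by rwa [σ.apply_symm_apply])

lemma map_lt_map_of_isMax_of_isMin (h : ∀ t, IsMax t → ¬ IsMax (σ t)) {t s : V}
    (ht : IsMax t) (hs : IsMin s) : σ t < σ s :=
  ((σ.map_rel_iff.2 (.inr ⟨ht, hs⟩)).resolve_right fun hσ ↦ h t ht hσ.1).lt

variable (σ) in
/-- The lower set of `V` generated by the preimages of the maximal elements of `W`. If no maximal
element of `V` is such a preimage, then `V` is the ordinal sum of `lowerPart σ` and `upperPart σ`,
and `W` is the ordinal sum of their images in the reverse order. -/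
def lowerPart : Set V := {v | ∃ t, IsMax (σ t) ∧ v ≤ t}

variable (σ) in
/-- The upper set of `V` generated by the preimages of the minimal elements of `W`; see
`IsLink.lowerPart`. -/
def upperPart : Set V := {v | ∃ s, IsMin (σ s) ∧ s ≤ v}

lemma lt_of_mem_lowerPart_of_mem_upperPart (h : ∀ t, IsMax t → ¬ IsMax (σ t)) {x y : V}
    (hx : x ∈ lowerPart σ) (hy : y ∈ upperPart σ) : x < y := by
  obtain ⟨t, ht, hxt⟩ := hx
  obtain ⟨s, hs, hsy⟩ := hy
  have hts : t < s := by simpa using map_lt_map_of_isMax_of_isMin (not_isMax_symm h) ht hs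
  exact hxt.trans_lt (hts.trans_le hsy)

lemma mem_lowerPart_or_mem_upperPart [Finite V] (h : ∀ t, IsMax t → ¬ IsMax (σ t)) (v : V) :
    v ∈ lowerPart σ ∨ v ∈ upperPart σ := by
  by_contra! ⟨hlow, hup⟩
  obtain ⟨t, ht, hvt⟩ := exists_isMax_ge v
  obtain ⟨s, hs, hsv⟩ := exists_isMin_le v
  have hσvt : σ v ≤ σ t := monotoneOn_of_forall_not_isMax_map Set.ordConnected_Ici
    (fun a ha hσa ↦ hlow ⟨a, hσa, ha⟩) Set.self_mem_Ici hvt hvt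
  have hσsv : σ s ≤ σ v := monotoneOn_of_forall_not_isMin_map Set.ordConnected_Iic
    (fun b hb hσb ↦ hup ⟨b, hσb, hb⟩) hsv Set.self_mem_Iic hsv
  exact (hσsv.trans hσvt).not_gt (map_lt_map_of_isMax_of_isMin h ht hs)

lemma monotoneOn_lowerPart [Finite V] (h : ∀ t, IsMax t → ¬ IsMax (σ t)) :
    MonotoneOn σ (lowerPart σ) := by
  have hlower : IsLowerSet (lowerPart σ) := fun a b hba ⟨t, ht, hat⟩ ↦ ⟨t, ht, hba.trans hat⟩
  exact monotoneOn_of_forall_not_isMin_map hlower.ordConnected fun b hb hσb ↦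
    (lt_of_mem_lowerPart_of_mem_upperPart h hb ⟨b, hσb, le_rfl⟩).false

lemma monotoneOn_upperPart [Finite V] (h : ∀ t, IsMax t → ¬ IsMax (σ t)) :
    MonotoneOn σ (upperPart σ) := by
  have hupper : IsUpperSet (upperPart σ) := fun a b hab ⟨s, hs, hsa⟩ ↦ ⟨s, hs, hsa.trans hab⟩
  exact monotoneOn_of_forall_not_isMax_map hupper.ordConnected fun a ha hσa ↦
    (lt_of_mem_lowerPart_of_mem_upperPart h ⟨a, hσa, le_rfl⟩ ha).false

lemma mapsTo_lowerPart [Finite V] (h : ∀ t, IsMax t → ¬ IsMax (σ t)) :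
    Set.MapsTo σ (lowerPart σ) (upperPart σ.symm) := by
  rintro v ⟨t, ht, hvt⟩
  obtain ⟨s, hs, hsv⟩ := exists_isMin_le v
  exact ⟨σ s, by rwa [σ.symm_apply_apply],
    monotoneOn_lowerPart h ⟨t, ht, hsv.trans hvt⟩ ⟨t, ht, hvt⟩ hsv⟩

lemma mapsTo_upperPart [Finite V] (h : ∀ t, IsMax t → ¬ IsMax (σ t)) :
    Set.MapsTo σ (upperPart σ) (lowerPart σ.symm) := by
  rintro v ⟨s, hs, hsv⟩
  obtain ⟨t, ht, hvt⟩ := exists_isMax_ge v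
  exact ⟨σ t, by rwa [σ.symm_apply_apply],
    monotoneOn_upperPart h ⟨s, hs, hsv⟩ ⟨s, hs, hsv.trans hvt⟩ hvt⟩

lemma map_le_map_iff_of_monotoneOn {S : Set V} {T : Set W} (hS : MonotoneOn σ S)
    (hT : MonotoneOn σ.symm T) (hST : Set.MapsTo σ S T) {i j : V} (hi : i ∈ S) (hj : j ∈ S) :
    σ i ≤ σ j ↔ i ≤ j :=
  ⟨fun hij ↦ by simpa using hT (hST hi) (hST hj) hij, fun hij ↦ hS hi hj hij⟩

open Classical in
theorem exists_potential [Finite V] [Finite W]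
    (σ : (IsLink : V → V → Prop) ≃r (IsLink : W → W → Prop)) :
    ∃ d : V → ℤ, ∀ i j,
      (if σ i ≤ σ j then 0 else 1) = (if i ≤ j then 0 else 1) + d i - d j := by
  by_cases! h : ∃ t, IsMax t ∧ IsMax (σ t)
  · obtain ⟨t, ht, hσt⟩ := h
    have hsymm : Monotone σ.symm := monotone_of_isMax_map hσt (by rwa [σ.symm_apply_apply])
    have hle (i j : V) : σ i ≤ σ j ↔ i ≤ j := map_le_map_iff_of_monotoneOn
      ((monotone_of_isMax_map ht hσt).monotoneOn _) (hsymm.monotoneOn _) (Set.mapsTo_univ _ _)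
      (Set.mem_univ i) (Set.mem_univ j)
    exact ⟨0, fun i j ↦ by simp [hle]⟩
  have h' := not_isMax_symm h
  refine ⟨fun i ↦ if i ∈ lowerPart σ then 1 else 0, fun i j ↦ ?_⟩
  have hnot {v : V} (hv : v ∈ upperPart σ) : v ∉ lowerPart σ := fun hv' ↦
    (lt_of_mem_lowerPart_of_mem_upperPart h hv' hv).false
  rcases mem_lowerPart_or_mem_upperPart h i with hi | hi <;>
    rcases mem_lowerPart_or_mem_upperPart h j with hj | hj
  · have hle : σ i ≤ σ j ↔ i ≤ j := map_le_map_iff_of_monotoneOn (monotoneOn_lowerPart h)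
      (monotoneOn_upperPart h') (mapsTo_lowerPart h) hi hj
    simp [hi, hj, hle]
  · have hij : i < j := lt_of_mem_lowerPart_of_mem_upperPart h hi hj
    have hσ : σ j < σ i := lt_of_mem_lowerPart_of_mem_upperPart h'
      (mapsTo_upperPart h hj) (mapsTo_lowerPart h hi)
    simp [hi, hnot hj, hij.le, hσ.not_ge]
  · have hji : j < i := lt_of_mem_lowerPart_of_mem_upperPart h hj hi
    have hσ : σ i < σ j := lt_of_mem_lowerPart_of_mem_upperPart h'
      (mapsTo_upperPart h hi) (mapsTo_lowerPart h hj)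
    simp [hnot hi, hj, hji.not_ge, hσ.le]
  · have hle : σ i ≤ σ j ↔ i ≤ j := map_le_map_iff_of_monotoneOn (monotoneOn_upperPart h)
      (monotoneOn_lowerPart h') (mapsTo_upperPart h) hi hj
    simp [hnot hi, hnot hj, hle]

end IsLink

end Poset

/-! ### Coordinates -/

namespace ExponentMatrix

variable {n : ℕ} (α : ExponentMatrix n)

/-- The excess `α i j + α j k - α i k` in the triangle inequality. It is the exponent of the
uniformizer in the product of the basis elements at `(i, j)` and `(j, k)` of the tiled order. -/
def defect (i j k : Fin n) : ℕ := α.exp i j + α.exp j k - α.exp i k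

lemma exp_add_defect (i j k : Fin n) :
    α.exp i k + α.defect i j k = α.exp i j + α.exp j k :=
  Nat.add_sub_cancel' (α.triangle i j k)

@[simp]
lemma defect_left_self (i k : Fin n) : α.defect i i k = 0 := by
  simp [defect, α.diag]

@[simp]
lemma defect_right_self (i k : Fin n) : α.defect i k k = 0 := by
  simp [defect, α.diag]

/-- An exponent matrix is reduced if no two distinct indices satisfy `α i j = α j i = 0`. These are
the exponent matrices of the basic tiled orders. -/
def IsReduced : Prop := ∀ i j, i ≠ j → 0 < α.exp i j + α.exp j i

variable {α}

/-- The index set of a reduced exponent matrix, with the partial order `i ≤ j ↔ α i j = 0`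
instead of that of `Fin n`. -/
def Vertex (_ : α.IsReduced) : Type := Fin n

namespace Vertex

variable {hα : α.IsReduced}

instance : Fintype (Vertex hα) := inferInstanceAs (Fintype (Fin n))

instance : DecidableEq (Vertex hα) := inferInstanceAs (DecidableEq (Fin n))

instance : PartialOrder (Vertex hα) where
  le (i j : Fin n) := α.exp i j = 0
  le_refl := α.diag
  le_trans (i j k : Fin n) hij hjk := by
    have := α.triangle i j k
    lia
  le_antisymm (i j : Fin n) hij hji := by
    by_contra h
    have := hα i j h
    lia

open Classical in
lemma exp_eq_ite (h01 : ∀ i j, α.exp i j = 0 ∨ α.exp i j = 1) (i j : Vertex hα) :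
    α.exp i j = if i ≤ j then 0 else 1 := by
  split_ifs with h
  · exact h
  · exact (h01 i j).resolve_left h

lemma isLink_iff_forall_lt_defect (h01 : ∀ i j, α.exp i j = 0 ∨ α.exp i j = 1)
    (i j : Vertex hα) :
    IsLink i j ↔ ∀ c : Vertex hα, c ≠ i → c ≠ j → (if i = j then 1 else 0) < α.defect j c i := by
  simp only [defect, exp_eq_ite h01]
  by_cases hji : j < i
  · rw [isLink_iff_of_lt hji, if_neg hji.ne', if_pos hji.le]
    grind
  · rw [isLink_iff_of_not_lt hji]
    rcases eq_or_ne i j with rfl | hij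
    · rw [if_pos rfl, if_pos le_rfl]
      grind
    · rw [if_neg hij, if_neg fun h ↦ hji (h.lt_of_ne' hij)]
      grind

end Vertex

end ExponentMatrix

namespace TiledOrder

open IsLocalRing (ResidueField residue)

variable {R K : Type*} [CommRing R] [IsDomain R] [IsDiscreteValuationRing R]
  [Field K] [Algebra R K] {n : ℕ} {α : ExponentMatrix n}

variable (R) in
/-- A fixed generator of the maximal ideal of a discrete valuation ring, used to normalize the
coordinates on a tiled order. -/
noncomputable def uniformizer : R := (IsDiscreteValuationRing.exists_irreducible R).choose

lemma irreducible_uniformizer : Irreducible (uniformizer R) :=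
  (IsDiscreteValuationRing.exists_irreducible R).choose_spec

lemma uniformizer_dvd_iff {r : R} :
    uniformizer R ∣ r ↔ r ∈ IsLocalRing.maximalIdeal R := by
  rw [irreducible_uniformizer.maximalIdeal_eq, Ideal.mem_span_singleton]

lemma mem_primePow_iff {a : ℕ} {x : K} :
    x ∈ primePow R K a ↔ ∃ r, algebraMap R K (uniformizer R ^ a * r) = x := by
  rw [primePow, irreducible_uniformizer.maximalIdeal_eq, Ideal.span_singleton_pow,
    IsLocalization.mem_coeSubmodule]
  simp only [Ideal.mem_span_singleton, dvd_def]
  exact ⟨fun ⟨_, ⟨r, hr⟩, hx⟩ ↦ ⟨r, hr ▸ hx⟩, fun ⟨r, hr⟩ ↦ ⟨_, ⟨r, rfl⟩, hr⟩⟩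

lemma Induces.adj_iff {φ : order R K α ≃ₐ[R] order R K α} {σ : Equiv.Perm (Fin n)}
    (h : Induces φ σ) (i j : Fin n) :
    (linkGraph R K α).Adj (σ i) (σ j) ↔ (linkGraph R K α).Adj i j := by
  have hmul : (maxIdeal R K α j * maxIdeal R K α i).map φ.toLinearMap =
      maxIdeal R K α (σ j) * maxIdeal R K α (σ i) := by
    rw [← h i, ← h j]
    exact Submodule.map_mul _ _ φ.toAlgHom
  have hinf : (maxIdeal R K α j ⊓ maxIdeal R K α i).map φ.toLinearMap =
      maxIdeal R K α (σ j) ⊓ maxIdeal R K α (σ i) := by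
    rw [← h i, ← h j, Submodule.map_inf _ φ.injective]
  simp only [linkGraph, ← hmul, ← hinf]
  exact (Submodule.map_injective_of_injective φ.injective).ne_iff

variable [IsFractionRing R K]

lemma algebraMap_uniformizer_pow_mul_injective (a : ℕ) :
    Function.Injective fun r : R ↦ algebraMap R K (uniformizer R ^ a * r) :=
  (IsFractionRing.injective R K).comp
    (mul_right_injective₀ (pow_ne_zero a irreducible_uniformizer.ne_zero))

variable (R K α) in
/-- The element of the tiled order with entries `p ^ α i j * M i j`, where `p` is the
uniformizer. -/
noncomputable def ofCoord : Matrix (Fin n) (Fin n) R →ₗ[R] order R K α where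
  toFun M := ⟨.of fun i j ↦ algebraMap R K (uniformizer R ^ α.exp i j * M i j),
    fun _ _ ↦ mem_primePow_iff.2 ⟨_, rfl⟩⟩
  map_add' M N := by
    ext i j
    simp [mul_add]
  map_smul' r M := by
    ext i j
    change algebraMap R K (_ * (r * M i j)) = r • algebraMap R K _
    rw [Algebra.smul_def, ← map_mul, mul_left_comm]

lemma ofCoord_bijective : Function.Bijective (ofCoord R K α) := by
  refine ⟨fun M N h ↦ Matrix.ext fun i j ↦ ?_, fun x ↦ ?_⟩
  · exact algebraMap_uniformizer_pow_mul_injective (α.exp i j)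
      (congrFun₂ (congrArg Subtype.val h) i j)
  · choose M hM using fun i j ↦ mem_primePow_iff.1 (x.2 i j)
    exact ⟨.of M, Subtype.ext (Matrix.ext hM)⟩

/-- The coordinates of an element of a tiled order: its `(i, j)` entry is `p ^ α i j` times the
coordinate at `(i, j)`, where `p` is the uniformizer. -/
noncomputable def coord : order R K α ≃ₗ[R] Matrix (Fin n) (Fin n) R :=
  (LinearEquiv.ofBijective (ofCoord R K α) ofCoord_bijective).symm

lemma coe_apply (x : order R K α) (i j : Fin n) :
    (x : Matrix (Fin n) (Fin n) K) i j =
      algebraMap R K (uniformizer R ^ α.exp i j * coord x i j) :=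
  congrFun₂ (congrArg Subtype.val (coord.symm_apply_apply x).symm) i j

lemma coord_apply_eq_iff {x : order R K α} {i j : Fin n} {r : R} :
    coord x i j = r ↔ (x : Matrix (Fin n) (Fin n) K) i j =
      algebraMap R K (uniformizer R ^ α.exp i j * r) := by
  rw [coe_apply, (algebraMap_uniformizer_pow_mul_injective (α.exp i j)).eq_iff]

lemma coord_mul_apply (x y : order R K α) (i k : Fin n) :
    coord (x * y) i k =
      ∑ j, uniformizer R ^ α.defect i j k * (coord x i j * coord y j k) := by
  rw [coord_apply_eq_iff, MulMemClass.coe_mul, Matrix.mul_apply, Finset.mul_sum, map_sum]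
  refine Finset.sum_congr rfl fun j _ ↦ ?_
  rw [coe_apply, coe_apply, ← map_mul, mul_mul_mul_comm, ← pow_add, ← α.exp_add_defect, pow_add,
    mul_assoc]

@[simp]
lemma coord_one : coord (1 : order R K α) = 1 := by
  ext i j
  rw [coord_apply_eq_iff]
  rcases eq_or_ne i j with rfl | hij
  · simp [α.diag]
  · simp [hij]

@[simp]
lemma coord_idem (i : Fin n) : coord (idem R K α i) = Matrix.single i i 1 := by
  ext a b
  rw [coord_apply_eq_iff]
  by_cases hab : i = a ∧ i = b
  · simp [idem, ← hab.1, ← hab.2, α.diag]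
  · simp [idem, hab]

lemma mem_maxIdeal_iff {k : Fin n} {x : order R K α} :
    x ∈ maxIdeal R K α k ↔ uniformizer R ∣ coord x k k := by
  change (x : Matrix (Fin n) (Fin n) K) k k ∈ primePow R K 1 ↔ _
  simp only [mem_primePow_iff, coe_apply, α.diag, pow_zero, pow_one, one_mul,
    (IsFractionRing.injective R K).eq_iff, dvd_def, eq_comm]

variable (R K α) in
/-- The element `p ^ α i j * e_{ij}` of the tiled order, where `p` is the uniformizer. -/
noncomputable def matUnit (i j : Fin n) : order R K α := coord.symm (Matrix.single i j 1)

@[simp]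
lemma coord_matUnit (i j : Fin n) : coord (matUnit R K α i j) = Matrix.single i j 1 :=
  coord.apply_symm_apply _

lemma matUnit_self (i : Fin n) : matUnit R K α i i = idem R K α i :=
  coord.injective (by simp)

lemma matUnit_mul_matUnit (i j k : Fin n) :
    matUnit R K α i j * matUnit R K α j k =
      uniformizer R ^ α.defect i j k • matUnit R K α i k := by
  refine coord.injective (Matrix.ext fun a b ↦ ?_)
  rcases eq_or_ne i a with rfl | hi <;> rcases eq_or_ne k b with rfl | hk <;>
    simp [coord_mul_apply, Matrix.single_apply, *]

lemma idem_mul_mul_idem (x : order R K α) (i j : Fin n) :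
    idem R K α i * x * idem R K α j = coord x i j • matUnit R K α i j := by
  refine coord.injective (Matrix.ext fun a b ↦ ?_)
  rcases eq_or_ne i a with rfl | hi <;> rcases eq_or_ne j b with rfl | hj <;>
    simp [coord_mul_apply, Matrix.single_apply, *]

lemma completeOrthogonalIdempotents_idem : CompleteOrthogonalIdempotents (idem R K α) := by
  refine CompleteOrthogonalIdempotents.iff_ortho_complete.2 ⟨fun i j hij ↦ ?_, coord.injective ?_⟩
  · simpa [hij] using idem_mul_mul_idem (1 : order R K α) i j
  · simp [map_sum, Matrix.sum_single_one]

lemma IsBasic.isReduced (h : IsBasic R K α) : α.IsReduced := by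
  intro i j hij
  by_contra! hα
  have hdefect : α.defect i j i = 0 ∧ α.defect j i j = 0 := by
    simp only [ExponentMatrix.defect]
    lia
  have hab : matUnit R K α i j * matUnit R K α j i = idem R K α i := by
    rw [matUnit_mul_matUnit, hdefect.1, pow_zero, one_smul, matUnit_self]
  have hba : matUnit R K α j i * matUnit R K α i j = idem R K α j := by
    rw [matUnit_mul_matUnit, hdefect.2, pow_zero, one_smul, matUnit_self]
  exact not_isEmpty_iff.2 (nonempty_span_linearEquiv_span hab hba
    (completeOrthogonalIdempotents_idem.idem i) (completeOrthogonalIdempotents_idem.idem j))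
    (h i j hij)

/-! ### Characters -/

lemma residue_uniformizer_pow {a : ℕ} (ha : a ≠ 0) : residue R (uniformizer R ^ a) = 0 := by
  rw [map_pow, (IsLocalRing.residue_eq_zero_iff _).2 (uniformizer_dvd_iff.1 dvd_rfl), zero_pow ha]

lemma residue_coord_mul_apply_self (hα : α.IsReduced) (x y : order R K α) (k : Fin n) :
    residue R (coord (x * y) k k) = residue R (coord x k k) * residue R (coord y k k) := by
  rw [coord_mul_apply, map_sum, Finset.sum_eq_single k]
  · simp
  · intro j _ hjk
    have hdefect : α.defect k j k ≠ 0 := by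
      simpa [ExponentMatrix.defect, α.diag] using (hα k j hjk.symm).ne'
    rw [map_mul, residue_uniformizer_pow hdefect, zero_mul]
  · simp

/-- The character `Λ → R / P` that reduces the `(k, k)` entry; its kernel is `maxIdeal R K α k`. -/
noncomputable def character (hα : α.IsReduced) (k : Fin n) : order R K α →ₐ[R] ResidueField R where
  toFun x := residue R (coord x k k)
  map_one' := by simp
  map_mul' x y := residue_coord_mul_apply_self hα x y k
  map_zero' := by simp
  map_add' := by simp
  commutes' r := by
    simp [Algebra.algebraMap_eq_smul_one]

lemma character_apply (hα : α.IsReduced) (k : Fin n) (x : order R K α) :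
    character hα k x = residue R (coord x k k) := rfl

@[simp]
lemma character_idem (hα : α.IsReduced) (k i : Fin n) :
    character hα k (idem R K α i) = if k = i then 1 else 0 := by
  rcases eq_or_ne k i with rfl | h <;> simp [character_apply, *, Ne.symm]

lemma mem_maxIdeal_iff_character (hα : α.IsReduced) {k : Fin n} {x : order R K α} :
    x ∈ maxIdeal R K α k ↔ character hα k x = 0 := by
  rw [mem_maxIdeal_iff, uniformizer_dvd_iff, character_apply, IsLocalRing.residue_eq_zero_iff]

lemma isUnit_of_forall_character_ne_zero (hα : α.IsReduced) {x : order R K α}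
    (hx : ∀ k, character hα k x ≠ 0) : IsUnit x := by
  let M : Matrix (Fin n) (Fin n) R := .of fun i j ↦ uniformizer R ^ α.exp i j * coord x i j
  refine isUnit_of_eq_map_of_isUnit_det (M := M) (Matrix.ext fun i j ↦ coe_apply x i j) ?_
  have hM : ((residue R).mapMatrix M).det = ∏ k, residue R (M k k) :=
    det_eq_prod_diag_of_forall_not_le (m := ExponentMatrix.Vertex hα) fun i j hij ↦ by
      change residue R (uniformizer R ^ α.exp i j * coord x i j) = 0
      rw [map_mul, residue_uniformizer_pow hij, zero_mul]
  rw [← IsLocalRing.residue_ne_zero_iff_isUnit, RingHom.map_det, hM]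
  refine Finset.prod_ne_zero_iff.2 fun k _ ↦ ?_
  simpa [M, α.diag, character_apply] using hx k

lemma exists_character_eq (hα : α.IsReduced) (χ : order R K α →ₐ[R] ResidueField R) :
    ∃ k, character hα k = χ := by
  have hsum : ∑ k, χ (idem R K α k) ≠ 0 := by
    rw [← map_sum, completeOrthogonalIdempotents_idem.complete, map_one]
    exact one_ne_zero
  obtain ⟨k, -, hk⟩ := Finset.exists_ne_zero_of_sum_ne_zero hsum
  have hone : χ (idem R K α k) = 1 := by
    simpa [hk] using congrArg χ (completeOrthogonalIdempotents_idem.idem k).eq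
  refine ⟨k, AlgHom.ext fun x ↦ ?_⟩
  have hcorner := congrArg χ (idem_mul_mul_idem x k k)
  rw [matUnit_self, map_smul, map_mul, map_mul, hone, one_mul, mul_one] at hcorner
  rw [hcorner, Algebra.smul_def, mul_one]
  rfl

lemma character_injective (hα : α.IsReduced) :
    Function.Injective (character (R := R) (K := K) hα) := fun i j h ↦ by
  simpa using congrArg (· (idem R K α j)) h

variable (R K) in
/-- The indexing of all characters `Λ → R / P` of a basic tiled order by the vertices. -/
noncomputable def characterEquiv (hα : α.IsReduced) :
    Fin n ≃ (order R K α →ₐ[R] ResidueField R) :=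
  .ofBijective (character hα) ⟨character_injective hα, exists_character_eq hα⟩

/-- The permutation of the vertices induced by an automorphism of a basic tiled order, defined by
its action on the characters. -/
noncomputable def inducedPerm (hα : α.IsReduced) :
    (order R K α ≃ₐ[R] order R K α) →* Equiv.Perm (Fin n) :=
  (characterEquiv R K hα).symm.permCongrHom.toMonoidHom.comp
    { toFun φ := φ.arrowCongr .refl
      map_one' := rfl
      map_mul' _ _ := rfl }

lemma character_inducedPerm (hα : α.IsReduced) (φ : order R K α ≃ₐ[R] order R K α) (i : Fin n)
    (x : order R K α) : character hα (inducedPerm hα φ i) x = character hα i (φ.symm x) := by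
  have := (characterEquiv R K hα).apply_symm_apply (φ.arrowCongr .refl (character hα i))
  exact congrArg (· x) this

lemma induces_inducedPerm (hα : α.IsReduced) (φ : order R K α ≃ₐ[R] order R K α) :
    Induces φ (inducedPerm hα φ) := by
  intro i
  ext y
  rw [mem_maxIdeal_iff_character hα, character_inducedPerm, ← mem_maxIdeal_iff_character]
  exact Submodule.mem_map_equiv (e := φ.toLinearEquiv) _

lemma maxIdeal_injective : Function.Injective (maxIdeal R K α) := by
  intro i j hij
  by_contra h
  have hmem : idem R K α j ∈ maxIdeal R K α j := hij ▸ mem_maxIdeal_iff.2 (by simp [Ne.symm h])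
  exact irreducible_uniformizer.not_dvd_one (by simpa using mem_maxIdeal_iff.1 hmem)

lemma induces_iff (hα : α.IsReduced) {φ : order R K α ≃ₐ[R] order R K α}
    {σ : Equiv.Perm (Fin n)} : Induces φ σ ↔ inducedPerm hα φ = σ := by
  refine ⟨fun h ↦ Equiv.ext fun i ↦ ?_, ?_⟩
  · exact maxIdeal_injective ((induces_inducedPerm hα φ i).symm.trans (h i))
  · rintro rfl
    exact induces_inducedPerm hα φ

/-- The action of the automorphisms of a basic tiled order on its link graph. -/
noncomputable def linkGraphAction (hα : α.IsReduced) :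
    (order R K α ≃ₐ[R] order R K α) →* LinkGraphAut R K α where
  toFun φ := ⟨inducedPerm hα φ, (induces_inducedPerm hα φ).adj_iff _ _⟩
  map_one' := RelIso.ext fun i ↦ congrArg (· i) (map_one (inducedPerm (R := R) (K := K) hα))
  map_mul' φ ψ := RelIso.ext fun i ↦ congrArg (· i) (map_mul (inducedPerm hα) φ ψ)

lemma linkGraphAction_eq_iff (hα : α.IsReduced) {φ : order R K α ≃ₐ[R] order R K α}
    {σ : LinkGraphAut R K α} : linkGraphAction hα φ = σ ↔ Induces φ σ.toEquiv := by
  rw [induces_iff hα, ← RelIso.toEquiv_injective.eq_iff]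
  rfl

lemma inducedPerm_eq_one_of_mem_inner (hα : α.IsReduced) {φ : order R K α ≃ₐ[R] order R K α}
    (hφ : φ ∈ inner R (order R K α)) : inducedPerm hα φ = 1 := by
  obtain ⟨u, hu⟩ := hφ
  refine Equiv.ext fun i ↦ character_injective (R := R) (K := K) hα <| AlgHom.ext fun x ↦ ?_
  obtain ⟨y, rfl⟩ := φ.surjective x
  rw [character_inducedPerm, φ.symm_apply_apply, hu, mul_assoc, map_mul, mul_comm, ← map_mul]
  simp

/-! ### The link graph -/

lemma uniformizer_pow_dvd_pow_iff {a b : ℕ} :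
    uniformizer R ^ a ∣ uniformizer R ^ b ↔ a ≤ b :=
  pow_dvd_pow_iff irreducible_uniformizer.ne_zero irreducible_uniformizer.not_isUnit

variable (R K α) in
/-- The submodule `(P ^ (α i j + γ i j))` of the tiled order `(P ^ α i j)`. -/
def tiled (γ : Fin n → Fin n → ℕ) : Submodule R (order R K α) where
  carrier := {x | ∀ a b, uniformizer R ^ γ a b ∣ coord x a b}
  add_mem' hx hy a b := by simpa using dvd_add (hx a b) (hy a b)
  zero_mem' := by simp
  smul_mem' r x hx a b := by simpa using (hx a b).mul_left r

lemma mem_tiled {γ : Fin n → Fin n → ℕ} {x : order R K α} :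
    x ∈ tiled R K α γ ↔ ∀ a b, uniformizer R ^ γ a b ∣ coord x a b := .rfl

lemma smul_matUnit_mem_tiled_iff {γ : Fin n → Fin n → ℕ} {r : R} {a b : Fin n} :
    r • matUnit R K α a b ∈ tiled R K α γ ↔ uniformizer R ^ γ a b ∣ r := by
  refine ⟨fun h ↦ by simpa using mem_tiled.1 h a b, fun h i j ↦ ?_⟩
  by_cases hij : a = i ∧ b = j
  · simpa [← hij.1, ← hij.2] using h
  · simp [hij]

lemma sum_coord_smul_matUnit (x : order R K α) :
    ∑ a, ∑ b, coord x a b • matUnit R K α a b = x := by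
  simp_rw [← idem_mul_mul_idem, ← Finset.mul_sum, ← Finset.sum_mul,
    completeOrthogonalIdempotents_idem.complete, one_mul, mul_one]

lemma tiled_le_iff {γ : Fin n → Fin n → ℕ} {N : Submodule R (order R K α)} :
    tiled R K α γ ≤ N ↔ ∀ a b, uniformizer R ^ γ a b • matUnit R K α a b ∈ N := by
  refine ⟨fun h a b ↦ h (smul_matUnit_mem_tiled_iff.2 dvd_rfl), fun h x hx ↦ ?_⟩
  rw [← sum_coord_smul_matUnit x]
  refine N.sum_mem fun a _ ↦ N.sum_mem fun b _ ↦ ?_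
  obtain ⟨r, hr⟩ := hx a b
  rw [hr, mul_comm, mul_smul]
  exact N.smul_mem r (h a b)

lemma tiled_le_tiled_iff {γ δ : Fin n → Fin n → ℕ} :
    tiled R K α γ ≤ tiled R K α δ ↔ δ ≤ γ := by
  simp only [tiled_le_iff, smul_matUnit_mem_tiled_iff, uniformizer_pow_dvd_pow_iff, Pi.le_def]

lemma tiled_inf_tiled (γ δ : Fin n → Fin n → ℕ) :
    tiled R K α γ ⊓ tiled R K α δ = tiled R K α (γ ⊔ δ) := by
  ext x
  simp only [Submodule.mem_inf, mem_tiled, ← forall_and, Pi.sup_apply]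
  refine forall₂_congr fun a b ↦ ?_
  rcases le_total (γ a b) (δ a b) with h | h
  · simpa [h] using (pow_dvd_pow _ h).trans
  · simpa [h] using (pow_dvd_pow _ h).trans

lemma tiled_mul_tiled (γ δ : Fin n → Fin n → ℕ) :
    tiled R K α γ * tiled R K α δ =
      tiled R K α fun a b ↦ ⨅ c, (γ a c + δ c b + α.defect a c b) := by
  refine le_antisymm (Submodule.mul_le.2 fun x hx y hy a b ↦ ?_) (tiled_le_iff.2 fun a b ↦ ?_)
  · rw [coord_mul_apply]
    refine Finset.dvd_sum fun c _ ↦ ?_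
    calc uniformizer R ^ (⨅ c, (γ a c + δ c b + α.defect a c b))
      _ ∣ uniformizer R ^ (γ a c + δ c b + α.defect a c b) :=
        pow_dvd_pow _ (ciInf_le (OrderBot.bddBelow _) c)
      _ = uniformizer R ^ α.defect a c b * (uniformizer R ^ γ a c * uniformizer R ^ δ c b) := by
        ring
      _ ∣ _ := mul_dvd_mul_left _ (mul_dvd_mul (hx a c) (hy c b))
  · have : Nonempty (Fin n) := ⟨a⟩
    obtain ⟨c, hc⟩ := exists_eq_ciInf_of_finite (f := fun c ↦ γ a c + δ c b + α.defect a c b)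
    rw [← hc, pow_add, pow_add, mul_smul, ← matUnit_mul_matUnit, mul_smul, ← mul_smul_comm,
      ← smul_mul_assoc]
    exact Submodule.mul_mem_mul (smul_matUnit_mem_tiled_iff.2 dvd_rfl)
      (smul_matUnit_mem_tiled_iff.2 dvd_rfl)

lemma maxIdeal_eq_tiled (k : Fin n) :
    maxIdeal R K α k = tiled R K α fun a b ↦ if a = k ∧ b = k then 1 else 0 := by
  ext x
  rw [mem_maxIdeal_iff, mem_tiled]
  refine ⟨fun h a b ↦ ?_, fun h ↦ by simpa using h k k⟩
  split_ifs with hab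
  · simpa [hab.1, hab.2] using h
  · simp

lemma maxIdeal_mul_maxIdeal_le_inf (hα : α.IsReduced) (i j : Fin n) :
    maxIdeal R K α j * maxIdeal R K α i ≤ maxIdeal R K α j ⊓ maxIdeal R K α i := by
  refine Submodule.mul_le.2 fun x hx y hy ↦ ⟨?_, ?_⟩ <;>
    simp only [mem_maxIdeal_iff_character hα] at hx hy
  · exact (mem_maxIdeal_iff_character hα).2 (by rw [map_mul, hx, zero_mul])
  · exact (mem_maxIdeal_iff_character hα).2 (by rw [map_mul, hy, mul_zero])

lemma linkGraph_adj_iff (hα : α.IsReduced) (i j : Fin n) :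
    (linkGraph R K α).Adj i j ↔
      ∀ c, c ≠ i → c ≠ j → (if i = j then 1 else 0) < α.defect j c i := by
  have : Nonempty (Fin n) := ⟨i⟩
  have hle : (linkGraph R K α).Adj i j ↔
      ¬ maxIdeal R K α j ⊓ maxIdeal R K α i ≤ maxIdeal R K α j * maxIdeal R K α i :=
    not_congr ⟨fun h ↦ h.ge, (maxIdeal_mul_maxIdeal_le_inf hα i j).antisymm⟩
  rw [hle]
  simp only [maxIdeal_eq_tiled, tiled_mul_tiled, tiled_inf_tiled, tiled_le_tiled_iff, Pi.le_def,
    iInf_le_iff_exists_le, Pi.sup_apply]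
  refine ⟨fun h c hci hcj ↦ ?_, fun h hcorner ↦ ?_⟩
  · contrapose! h
    intro a b
    by_cases haj : a = j
    · by_cases hbi : b = i
      · exact ⟨c, by subst haj hbi; simpa [hci, hcj, eq_comm, and_comm] using h⟩
      · exact ⟨b, by simp [haj, hbi]⟩
    · exact ⟨a, by simp [haj]⟩
  · obtain ⟨c, hc⟩ := hcorner j i
    grind

/-! ### Lifting automorphisms of the link graph -/

open Classical in
lemma exists_potential_of_linkGraphAut (hα : α.IsReduced)
    (h01 : ∀ i j, α.exp i j = 0 ∨ α.exp i j = 1) (σ : LinkGraphAut R K α) :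
    ∃ d : Fin n → ℤ, ∀ i j, (α.exp (σ i) (σ j) : ℤ) = α.exp i j + d i - d j := by
  have hadj (i j : ExponentMatrix.Vertex hα) : (linkGraph R K α).Adj i j ↔ IsLink i j :=
    (linkGraph_adj_iff hα i j).trans
      (ExponentMatrix.Vertex.isLink_iff_forall_lt_defect h01 i j).symm
  have hexp (i j : ExponentMatrix.Vertex hα) : (α.exp i j : ℤ) = if i ≤ j then 0 else 1 := by
    rw [ExponentMatrix.Vertex.exp_eq_ite h01, Nat.cast_ite, Nat.cast_zero, Nat.cast_one]
  let τ : (IsLink : ExponentMatrix.Vertex hα → ExponentMatrix.Vertex hα → Prop) ≃r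
      (IsLink : ExponentMatrix.Vertex hα → ExponentMatrix.Vertex hα → Prop) :=
    ⟨σ.toEquiv, (hadj _ _).symm.trans (σ.map_rel_iff.trans (hadj _ _))⟩
  obtain ⟨d, hd⟩ := IsLink.exists_potential τ
  simp only [← hexp] at hd
  exact ⟨d, hd⟩

lemma defect_linkGraphAut (hα : α.IsReduced) (h01 : ∀ i j, α.exp i j = 0 ∨ α.exp i j = 1)
    (σ : LinkGraphAut R K α) (i j k : Fin n) :
    α.defect (σ i) (σ j) (σ k) = α.defect i j k := by
  obtain ⟨d, hd⟩ := exists_potential_of_linkGraphAut hα h01 σ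
  have h := α.exp_add_defect i j k
  have hσ := α.exp_add_defect (σ i) (σ j) (σ k)
  have := hd i j
  have := hd j k
  have := hd i k
  lia

/-- The automorphism of a tiled order that permutes the coordinates by a permutation of the
vertices which preserves the defects. -/
noncomputable def permAut (σ : Equiv.Perm (Fin n))
    (hσ : ∀ i j k, α.defect (σ i) (σ j) (σ k) = α.defect i j k) :
    order R K α ≃ₐ[R] order R K α :=
  .ofLinearEquiv (coord ≪≫ₗ Matrix.reindexLinearEquiv R R σ σ ≪≫ₗ coord.symm)
    (coord.injective (by simp)) fun x y ↦ by
      refine coord.injective (Matrix.ext fun i k ↦ ?_)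
      obtain ⟨i, rfl⟩ := σ.surjective i
      obtain ⟨k, rfl⟩ := σ.surjective k
      simpa [coord_mul_apply] using Fintype.sum_equiv σ _ _ fun j ↦ by simp [hσ]

lemma coord_permAut {σ : Equiv.Perm (Fin n)}
    (hσ : ∀ i j k, α.defect (σ i) (σ j) (σ k) = α.defect i j k) (x : order R K α) :
    coord (permAut σ hσ x) = Matrix.reindex σ σ (coord x) :=
  coord.apply_symm_apply _

lemma induces_permAut {σ : Equiv.Perm (Fin n)}
    (hσ : ∀ i j k, α.defect (σ i) (σ j) (σ k) = α.defect i j k) :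
    Induces (permAut (R := R) (K := K) σ hσ) σ := by
  intro i
  ext y
  obtain ⟨x, rfl⟩ := (permAut σ hσ).surjective y
  rw [mem_maxIdeal_iff, coord_permAut]
  simp [mem_maxIdeal_iff]

/-- The splitting of `linkGraphAction` given by permuting the coordinates. -/
noncomputable def linkGraphLift (hα : α.IsReduced)
    (h01 : ∀ i j, α.exp i j = 0 ∨ α.exp i j = 1) :
    LinkGraphAut R K α →* (order R K α ≃ₐ[R] order R K α) where
  toFun σ := permAut σ.toEquiv (defect_linkGraphAut hα h01 σ)
  map_one' := AlgEquiv.ext fun x ↦ coord.injective (coord_permAut _ x)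
  map_mul' σ τ := AlgEquiv.ext fun x ↦ coord.injective <| by
    rw [AlgEquiv.mul_apply]
    simp only [coord_permAut]
    rfl

lemma linkGraphAction_linkGraphLift (hα : α.IsReduced)
    (h01 : ∀ i j, α.exp i j = 0 ∨ α.exp i j = 1) (σ : LinkGraphAut R K α) :
    linkGraphAction hα (linkGraphLift hα h01 σ) = σ :=
  (linkGraphAction_eq_iff hα).2 (induces_permAut (defect_linkGraphAut hα h01 σ))

/-! ### Inner automorphisms -/

variable (R K α) in
/-- The embedding of the diagonal matrices over `R` into a tiled order. -/
noncomputable def diagHom : (Fin n → R) →* order R K α where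
  toFun d := coord.symm (Matrix.diagonal d)
  map_one' := coord.injective (by simp)
  map_mul' d d' := by
    refine coord.injective (Matrix.ext fun i k ↦ ?_)
    rcases eq_or_ne i k with rfl | hik <;> simp [coord_mul_apply, Matrix.diagonal_apply, *]

@[simp]
lemma coord_diagHom (d : Fin n → R) : coord (diagHom R K α d) = Matrix.diagonal d :=
  coord.apply_symm_apply _

lemma coord_diagHom_mul_apply (d : Fin n → R) (x : order R K α) (i j : Fin n) :
    coord (diagHom R K α d * x) i j = d i * coord x i j := by
  simp [coord_mul_apply, Matrix.diagonal_apply]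

lemma coord_mul_diagHom_apply (d : Fin n → R) (x : order R K α) (i j : Fin n) :
    coord (x * diagHom R K α d) i j = coord x i j * d j := by
  simp [coord_mul_apply, Matrix.diagonal_apply]

lemma coord_smul_matUnit_of_map_idem {φ : order R K α ≃ₐ[R] order R K α}
    (hφ : ∀ i, φ (idem R K α i) = idem R K α i) (x : order R K α) (i j : Fin n) :
    coord (φ x) i j • matUnit R K α i j = coord x i j • φ (matUnit R K α i j) := by
  rw [← idem_mul_mul_idem, ← map_smul, ← idem_mul_mul_idem, map_mul, map_mul, hφ, hφ]

lemma coord_apply_of_map_idem {φ : order R K α ≃ₐ[R] order R K α}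
    (hφ : ∀ i, φ (idem R K α i) = idem R K α i) (x : order R K α) (i j : Fin n) :
    coord (φ x) i j = coord x i j * coord (φ (matUnit R K α i j)) i j := by
  simpa using congrArg (fun y ↦ coord y i j) (coord_smul_matUnit_of_map_idem hφ x i j)

lemma isUnit_coord_map_matUnit {φ : order R K α ≃ₐ[R] order R K α}
    (hφ : ∀ i, φ (idem R K α i) = idem R K α i) (i j : Fin n) :
    IsUnit (coord (φ (matUnit R K α i j)) i j) := by
  have h := coord_apply_of_map_idem hφ (φ.symm (matUnit R K α i j)) i j
  rw [φ.apply_symm_apply] at h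
  exact .of_mul_eq_one_right _ (by simpa using h.symm)

lemma coord_map_matUnit_mul {φ : order R K α ≃ₐ[R] order R K α}
    (hφ : ∀ i, φ (idem R K α i) = idem R K α i) (i j k : Fin n) :
    coord (φ (matUnit R K α i j)) i j * coord (φ (matUnit R K α j k)) j k =
      coord (φ (matUnit R K α i k)) i k := by
  have hmap (a b : Fin n) :
      φ (matUnit R K α a b) = coord (φ (matUnit R K α a b)) a b • matUnit R K α a b := by
    simpa using (coord_smul_matUnit_of_map_idem hφ (matUnit R K α a b) a b).symm
  have h := congrArg (fun y ↦ coord (φ y) i k)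
    (matUnit_mul_matUnit (R := R) (K := K) (α := α) i j k)
  simp only [map_mul, map_smul] at h
  rw [hmap i j, hmap j k, smul_mul_smul_comm, matUnit_mul_matUnit] at h
  refine mul_left_cancel₀ (pow_ne_zero (α.defect i j k) irreducible_uniformizer.ne_zero) ?_
  simpa [mul_comm] using h

lemma mem_inner_of_map_idem {φ : order R K α ≃ₐ[R] order R K α}
    (hφ : ∀ i, φ (idem R K α i) = idem R K α i) : φ ∈ inner R (order R K α) := by
  rcases isEmpty_or_nonempty (Fin n) with hn | ⟨⟨k⟩⟩
  · exact ⟨1, fun x ↦ coord.injective (Subsingleton.elim _ _)⟩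
  let d (i : Fin n) : R := coord (φ (matUnit R K α i k)) i k
  have hd : IsUnit d := Pi.isUnit_iff.2 fun i ↦ isUnit_coord_map_matUnit hφ i k
  refine mem_inner_of_isUnit (hd.map (diagHom R K α)) fun x ↦ ?_
  refine coord.injective (Matrix.ext fun i j ↦ ?_)
  rw [coord_mul_diagHom_apply, coord_diagHom_mul_apply, coord_apply_of_map_idem hφ, mul_assoc,
    coord_map_matUnit_mul hφ, mul_comm]

lemma mem_inner_of_inducedPerm_eq_one (hα : α.IsReduced) {φ : order R K α ≃ₐ[R] order R K α}
    (hφ : inducedPerm hα φ = 1) : φ ∈ inner R (order R K α) := by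
  have hχ (k : Fin n) (x : order R K α) : character hα k (φ x) = character hα k x := by
    simpa [hφ] using character_inducedPerm hα φ k (φ x)
  obtain ⟨u, hu⟩ : IsUnit (∑ i, φ (idem R K α i) * idem R K α i) :=
    isUnit_of_forall_character_ne_zero hα fun k ↦ by simp [map_sum, hχ]
  have hidem := (completeOrthogonalIdempotents_idem (R := R) (K := K) (α := α)).1
  have hconj (i : Fin n) : φ (idem R K α i) * u = u * idem R K α i := by
    rw [hu]
    exact mul_sum_mul_eq_sum_mul_mul_of_orthogonalIdempotents hidem (hidem.map φ.toRingHom) i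
  let ψ : order R K α ≃ₐ[R] order R K α := MulSemiringAction.toAlgEquiv R _ (ConjAct.toConjAct u)
  have hψ : ψ ∈ inner R (order R K α) := ⟨u, fun x ↦ rfl⟩
  have hfix (i : Fin n) : (ψ⁻¹ * φ) (idem R K α i) = idem R K α i :=
    ψ.symm_apply_eq.2 ((Units.eq_mul_inv_iff_mul_eq u).2 (hconj i))
  simpa using mul_mem hψ (mem_inner_of_map_idem hfix)

lemma ker_linkGraphAction (hα : α.IsReduced) :
    (linkGraphAction (R := R) (K := K) hα).ker = inner R (order R K α) := by
  ext φ
  rw [MonoidHom.mem_ker, linkGraphAction_eq_iff, induces_iff hα]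
  exact ⟨mem_inner_of_inducedPerm_eq_one hα, inducedPerm_eq_one_of_mem_inner hα⟩

variable (R K) in
/-- The extension `1 → Inn(Λ) → Aut_R(Λ) → Aut(Q(Λ)) → 1` of a basic tiled `(0,1)`-order `Λ`. -/
noncomputable def linkGraphExtension (hα : α.IsReduced)
    (h01 : ∀ i j, α.exp i j = 0 ∨ α.exp i j = 1) :
    GroupExtension (inner R (order R K α)) (order R K α ≃ₐ[R] order R K α)
      (LinkGraphAut R K α) where
  inl := (inner R (order R K α)).subtype
  rightHom := linkGraphAction hα
  inl_injective := Subtype.val_injective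
  range_inl_eq_ker_rightHom := by rw [Subgroup.range_subtype, ker_linkGraphAction]
  rightHom_surjective σ := ⟨linkGraphLift hα h01 σ, linkGraphAction_linkGraphLift hα h01 σ⟩

variable (R K) in
/-- The splitting of `linkGraphExtension` that permutes the coordinates. -/
noncomputable def linkGraphSplitting (hα : α.IsReduced)
    (h01 : ∀ i j, α.exp i j = 0 ∨ α.exp i j = 1) :
    (linkGraphExtension R K hα h01).Splitting where
  toMonoidHom := linkGraphLift hα h01
  rightInverse_rightHom := linkGraphAction_linkGraphLift hα h01

end TiledOrder

theorem theorem8_general {R K : Type*} [CommRing R] [IsDomain R] [IsDiscreteValuationRing R]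
    [Field K] [Algebra R K] [IsFractionRing R K]
    {n : ℕ} (α : ExponentMatrix n)
    (hbasic : TiledOrder.IsBasic R K α)
    (h01 : ∀ i j, α.exp i j = 0 ∨ α.exp i j = 1) :
    (∀ σ : TiledOrder.LinkGraphAut R K α, TiledOrder.IsLiftable σ) ∧
    ∃ (θ : TiledOrder.LinkGraphAut R K α →*
          MulAut (TiledOrder.inner R (TiledOrder.order R K α)))
      (e : TiledOrder.inner R (TiledOrder.order R K α) ⋊[θ] TiledOrder.LinkGraphAut R K α ≃*
          (TiledOrder.order R K α ≃ₐ[R] TiledOrder.order R K α)),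
      (∀ u : TiledOrder.inner R (TiledOrder.order R K α),
        e (SemidirectProduct.inl u) = u) ∧
      (∀ σ : TiledOrder.LinkGraphAut R K α,
        TiledOrder.Induces (e (SemidirectProduct.inr σ)) σ.toEquiv) := by
  have hα : α.IsReduced := hbasic.isReduced
  have hlift (σ : TiledOrder.LinkGraphAut R K α) :
      TiledOrder.Induces (TiledOrder.linkGraphLift hα h01 σ) σ.toEquiv :=
    (TiledOrder.linkGraphAction_eq_iff hα).1 (TiledOrder.linkGraphAction_linkGraphLift hα h01 σ)
  let s := TiledOrder.linkGraphSplitting R K hα h01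
  have hinl (u : TiledOrder.inner R (TiledOrder.order R K α)) :
      s.semidirectProductMulEquiv (SemidirectProduct.inl u) = u :=
    (congrArg (u.1 * ·) (map_one s)).trans (mul_one u.1)
  have hinr (σ : TiledOrder.LinkGraphAut R K α) :
      s.semidirectProductMulEquiv (SemidirectProduct.inr σ) = TiledOrder.linkGraphLift hα h01 σ :=
    one_mul _
  exact ⟨fun σ ↦ ⟨_, hlift σ⟩, s.conjAct, s.semidirectProductMulEquiv, hinl,
    fun σ ↦ hinr σ ▸ hlift σ⟩

theorem theorem8 {R K : Type*} [CommRing R] [IsDomain R] [IsDiscreteValuationRing R]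
    [IsAdicComplete (IsLocalRing.maximalIdeal R) R]
    [Field K] [Algebra R K] [IsFractionRing R K]
    {n : ℕ} (α : ExponentMatrix n)
    (hbasic : TiledOrder.IsBasic R K α)
    (h01 : ∀ i j, α.exp i j = 0 ∨ α.exp i j = 1) :
    (∀ σ : TiledOrder.LinkGraphAut R K α, TiledOrder.IsLiftable σ) ∧
    ∃ (θ : TiledOrder.LinkGraphAut R K α →*
          MulAut (TiledOrder.inner R (TiledOrder.order R K α)))
      (e : TiledOrder.inner R (TiledOrder.order R K α) ⋊[θ] TiledOrder.LinkGraphAut R K α ≃*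
          (TiledOrder.order R K α ≃ₐ[R] TiledOrder.order R K α)),
      (∀ u : TiledOrder.inner R (TiledOrder.order R K α),
        e (SemidirectProduct.inl u) = u) ∧
      (∀ σ : TiledOrder.LinkGraphAut R K α,
        TiledOrder.Induces (e (SemidirectProduct.inr σ)) σ.toEquiv) :=
  theorem8_general α hbasic h01
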